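/- Let $\Omega\subset\mathbb{R}^n$ be a smoothly bounded open set, i.e. $\Omega=\{x\in\mathbb{R}^n: r(x)<0\}$ for some $C^\infty$ function $r:\mathbb{R}^n\to\mathbb{R}$ with $\{r=0\}=b\Omega$ (the topological boundary) and $\nabla r\neq 0$ in a neighborhood of $b\Omega$. Let $p\in b\Omega$ and let $U\subset\mathbb{R}^n$ be an open neighborhood of $p$. For a $C^2$ function $f$ write $H_f(\xi,\zeta)(x)=\sum_{j,k=1}^n\frac{\partial^2 f}{\partial x_j\partial x_k}(x)\,\xi_j\zeta_k$. Suppose that $\Omega$ is convex in $U$, in the sense that for some local defining function $\rho$ of $\Omega$ on $U$ (that is, $\rho\in C^\infty(U)$, $\Omega\cap U=\{x\in U:\rho(x)<0\}$ and $\nabla\rho\neq 0$ on $b\Omega\cap U$) one has $$H_\rho(\xi,\xi)(q)\ge 0\qquad\text{for all } q\in b\Omega\cap U \text{ and all } \xi\in\mathbb{R}^n \text{ with } \langle\nabla\rho(q),\xi\rangle=0 .$$ Let $\delta$ be the signed distance to the boundary: $\delta(x)=-\inf_{z\in b\Omega}\|x-z\|$ for $x\in\Omega$ and $\delta(x)=\inf_{z\in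 b\Omega}\|x-z\|$ for $x\in\mathbb{R}^n\setminus\Omega$. Then $\delta$ is $C^\infty$ on an open set containing $b\Omega\cap U$, and $\delta$ is convex on $b\Omega\cap U$ in the sense that $$H_\delta(\xi,\xi)(x)\ge 0\qquad\text{for all } x\in b\Omega\cap U \text{ and all } \xi\in\mathbb{R}^n .$$ -/

import Mathlib

open scoped ContDiff

/-- `ℝⁿ` with the Euclidean norm. -/
abbrev Eucl (n : ℕ) : Type := EuclideanSpace ℝ (Fin n)

/-- The partial derivative `∂f/∂x_j`. -/
noncomputable def partialDeriv {n : ℕ} (j : Fin n) (f : Eucl n → ℝ) (x : Eucl n) : ℝ :=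
  fderiv ℝ f x (EuclideanSpace.single j 1)

/-- The real Hessian `H_f(ξ, ζ)(x) = ∑_{j,k} ∂²f/∂x_j∂x_k(x) ξ_j ζ_k`. -/
noncomputable def realHessian {n : ℕ} (f : Eucl n → ℝ) (ξ ζ : Eucl n) (x : Eucl n) : ℝ :=
  ∑ j : Fin n, ∑ k : Fin n, partialDeriv j (partialDeriv k f) x * ξ j * ζ k

/-- The open set `Ω` is smoothly bounded: it is `{r < 0}` for a `C^∞` function `r` on `ℝⁿ` with
`{r = 0} = bΩ` and with nowhere vanishing gradient in a neighborhood of `bΩ`. -/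
def IsSmoothlyBounded {n : ℕ} (Ω : Set (Eucl n)) : Prop :=
  IsOpen Ω ∧ ∃ r : Eucl n → ℝ, ContDiff ℝ ∞ r ∧ Ω = {x | r x < 0} ∧ {x | r x = 0} = frontier Ω ∧
    ∃ W : Set (Eucl n), IsOpen W ∧ frontier Ω ⊆ W ∧ ∀ x ∈ W, gradient r x ≠ 0

/-- `r` is a (smooth, nondegenerate) local defining function for `Ω` on the open set `U`. Only the
values of `r` on `U` matter. -/
def IsLocalDefiningFunction {n : ℕ} (Ω U : Set (Eucl n)) (r : Eucl n → ℝ) : Prop :=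
  ContDiffOn ℝ ∞ r U ∧ Ω ∩ U = {x | x ∈ U ∧ r x < 0} ∧ ∀ x ∈ frontier Ω ∩ U, gradient r x ≠ 0

/-- The tangent space at `x` of the boundary, described by a local defining function `r`:
the `ξ` with `⟨∇r(x), ξ⟩ = 0`. -/
def boundaryTangentSpace {n : ℕ} (r : Eucl n → ℝ) (x : Eucl n) : Set (Eucl n) :=
  {ξ | inner ℝ (gradient r x) ξ = 0}

/-- `Ω` is convex in the open set `U`: the Hessian of a local defining function on `U` is nonnegative
in all directions tangent to `bΩ`, at all points of `U ∩ bΩ`. The tangential sign condition does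
not depend on the local defining function, so that asking for one of them is enough. -/
def IsConvexDomainIn {n : ℕ} (Ω U : Set (Eucl n)) : Prop :=
  ∃ r : Eucl n → ℝ, IsLocalDefiningFunction Ω U r ∧
    ∀ q ∈ U ∩ frontier Ω, ∀ ξ ∈ boundaryTangentSpace r q, 0 ≤ realHessian r ξ ξ q

open Classical in
/-- The signed distance to the boundary: `-d(x, bΩ)` on `Ω` and `d(x, bΩ)` off `Ω`. -/
noncomputable def signedBoundaryDist {n : ℕ} (Ω : Set (Eucl n)) (x : Eucl n) : ℝ :=
  if x ∈ Ω then -Metric.infDist x (frontier Ω) else Metric.infDist x (frontier Ω)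

/-!
Let `N = ∇ρ / ‖∇ρ‖`. The map `(z, t) ↦ (z + t • N z, ρ z)` has an invertible derivative at a
boundary point `(p, 0)`, hence a local inverse as smooth as `N`. For `x` near `p`, Lagrange
multipliers put `x` on the normal line through a nearest boundary point `z`, and `ρ` increases along
`N`, so this map sends `(z, δ x)` to `(x, 0)`. Thus `δ` and the foot point `π x = z` are as smooth
as `N`, one degree less than `ρ`. Differentiating `x = π x + δ x • N (π x)` and pairing with the
normal gives `∇δ = N ∘ π`, which restores the lost degree. On the boundary the derivative of `π` is
the projection `ξ ↦ ξᵀ` to the tangent space, so a second differentiation yields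
`‖∇ρ‖ * H_δ(ξ, ζ) = H_ρ(ξᵀ, ζᵀ)`: tangential convexity of `ρ` is convexity of `δ` in all directions.
-/

open Filter NormedSpace
open scoped Topology RealInnerProductSpace

section Calculus

variable {𝕜 E F : Type*} [RCLike 𝕜] [NormedAddCommGroup E] [NormedSpace 𝕜 E]
  [NormedAddCommGroup F] [NormedSpace 𝕜 F] {k : WithTop ℕ∞}

lemma eventually_contDiffAt_succ {f : E → F} {a : E} (hk : 1 ≤ k)
    (hf : ∀ᶠ x in 𝓝 a, ContDiffAt 𝕜 k f x)
    (hf' : ∀ᶠ x in 𝓝 a, ContDiffAt 𝕜 k (fderiv 𝕜 f) x) :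
    ∀ᶠ x in 𝓝 a, ContDiffAt 𝕜 (k + 1) f x := by
  obtain ⟨s, hs, hso, has⟩ := eventually_nhds_iff.1 (hf.and hf')
  have hfs : ContDiffOn 𝕜 k f s := fun x hx => (hs x hx).1.contDiffWithinAt
  have hsucc : ContDiffOn 𝕜 (k + 1) f s := by
    refine (contDiffOn_succ_iff_fderiv_of_isOpen hso).2
      ⟨hfs.differentiableOn (by positivity), ?_, fun x hx => (hs x hx).2.contDiffWithinAt⟩
    rintro rfl
    exact hfs.analyticOn
  filter_upwards [hso.mem_nhds has] with x hx
  exact hsucc.contDiffAt (hso.mem_nhds hx)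

lemma exists_localInverse_eventually_contDiffAt [CompleteSpace E] {f : E → F} {f' : E ≃L[𝕜] F}
    {a : E} (hk : 1 ≤ k) (hf : ∀ᶠ x in 𝓝 a, ContDiffAt 𝕜 k f x)
    (hf' : HasFDerivAt f (f' : E →L[𝕜] F) a) :
    ∃ g : F → E, (∀ᶠ x in 𝓝 a, g (f x) = x) ∧ ∀ᶠ y in 𝓝 (f a), ContDiffAt 𝕜 k g y := by
  have hk0 : k ≠ 0 := by positivity
  have hfa := hf.self_of_nhds
  let e := hfa.toOpenPartialHomeomorph f hf' hk0
  have ha : a ∈ e.source := hfa.mem_toOpenPartialHomeomorph_source hf' hk0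
  have hfat : f a ∈ e.target := e.map_source ha
  have hcont : Tendsto e.symm (𝓝 (f a)) (𝓝 a) := by
    have hsymm : e.symm (f a) = a := e.left_inv ha
    simpa only [ContinuousAt, hsymm] using e.continuousAt_symm hfat
  have hinv : ∀ᶠ x in 𝓝 a, fderiv 𝕜 f x ∈ Set.range ((↑) : (E ≃L[𝕜] F) → E →L[𝕜] F) := by
    refine (hfa.continuousAt_fderiv hk0).eventually_mem ?_
    rw [hf'.fderiv]
    exact f'.nhds
  refine ⟨e.symm, e.eventually_left_inverse ha, ?_⟩
  filter_upwards [e.open_target.mem_nhds hfat, hcont.eventually hinv, hcont.eventually hf]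
    with y hy ⟨A, hA⟩ hfy
  refine e.contDiffAt_symm hy (f₀' := A) ?_ hfy
  rw [hA]
  exact (hfy.differentiableAt hk0).hasFDerivAt

end Calculus

section Frontier

lemma eq_zero_of_mem_frontier_of_mem_iff_neg {X : Type*} [TopologicalSpace X] {s : Set X}
    {f : X → ℝ} {x : X} (hf : ContinuousAt f x) (hs : ∀ᶠ y in 𝓝 x, y ∈ s ↔ f y < 0)
    (hx : x ∈ frontier s) : f x = 0 := by
  refine le_antisymm (not_lt.1 fun hpos => ?_) (not_lt.1 fun hneg => hx.2 ?_)
  · obtain ⟨y, hys, hy, hfy⟩ := (mem_closure_iff_frequently.1 hx.1).and_eventually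
      (hs.and (hf.eventually_const_lt hpos)) |>.exists
    exact lt_asymm (hy.1 hys) hfy
  · rw [mem_interior_iff_mem_nhds]
    filter_upwards [hs, hf.eventually_lt_const hneg] with y hy hfy using hy.2 hfy

end Frontier

section NearestPoint

lemma tendsto_of_infDist_eq_dist {X : Type*} [PseudoMetricSpace X] {s : Set X} {p : X} {z : X → X}
    (hp : p ∈ s) (hz : ∀ x, Metric.infDist x s = dist x (z x)) : Tendsto z (𝓝 p) (𝓝 p) := by
  rw [tendsto_iff_dist_tendsto_zero]
  have hlim : Tendsto (fun x => 2 * dist x p) (𝓝 p) (𝓝 0) := by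
    simpa using (tendsto_id.dist tendsto_const_nhds : Tendsto (dist · p) (𝓝 p) _).const_mul 2
  refine squeeze_zero (fun _ => dist_nonneg) (fun x => ?_) hlim
  calc dist (z x) p ≤ dist x (z x) + dist x p := dist_triangle_left _ _ _
    _ ≤ dist x p + dist x p := by gcongr; exact hz x ▸ Metric.infDist_le_dist_of_mem hp
    _ = 2 * dist x p := by ring

end NearestPoint

section UnitNormal

variable {E : Type*} [NormedAddCommGroup E] [InnerProductSpace ℝ E]

lemma inner_fderiv_eq_zero_of_eventually_norm_eq_one {F : Type*} [NormedAddCommGroup F]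
    [NormedSpace ℝ F] {u : F → E} {x : F} (hu : DifferentiableAt ℝ u x)
    (h : ∀ᶠ y in 𝓝 x, ‖u y‖ = 1) (v : F) : ⟪fderiv ℝ u x v, u x⟫ = 0 := by
  have hconst : (fun y => ⟪u y, u y⟫) =ᶠ[𝓝 x] fun _ => 1 := by
    filter_upwards [h] with y hy
    rw [real_inner_self_eq_norm_sq, hy, one_pow]
  have hderiv := fderiv_inner_apply ℝ hu hu v
  rw [hconst.fderiv_eq, fderiv_const_apply, real_inner_comm (fderiv ℝ u x v)] at hderiv
  rw [zero_apply] at hderiv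
  linarith

variable [CompleteSpace E] {ρ : E → ℝ} {p : E} {k : WithTop ℕ∞}

/-- The unit normal `∇ρ / ‖∇ρ‖` to the level sets of `ρ`; it is `0` at critical points. -/
noncomputable def unitNormal (ρ : E → ℝ) (x : E) : E := normalize (gradient ρ x)

/-- The component of `ξ` at `p` tangent to the level set of `ρ`. -/
noncomputable def tangentialPart (ρ : E → ℝ) (p ξ : E) : E :=
  ξ - ⟪unitNormal ρ p, ξ⟫ • unitNormal ρ p

lemma contDiffAt_gradient (hρ : ContDiffAt ℝ (k + 1) ρ p) : ContDiffAt ℝ k (gradient ρ) p :=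
  (InnerProductSpace.toDual ℝ E).symm.contDiff.contDiffAt.comp p (hρ.fderiv_right le_rfl)

lemma contDiffAt_unitNormal (hρ : ContDiffAt ℝ (k + 1) ρ p) (hp : gradient ρ p ≠ 0) :
    ContDiffAt ℝ k (unitNormal ρ) p :=
  (((contDiffAt_gradient hρ).norm ℝ hp).inv (norm_ne_zero_iff.2 hp)).smul (contDiffAt_gradient hρ)

lemma continuousAt_unitNormal (hρ : ContDiffAt ℝ 1 ρ p) (hp : gradient ρ p ≠ 0) :
    ContinuousAt (unitNormal ρ) p :=
  (contDiffAt_unitNormal (k := 0) (by rwa [zero_add]) hp).continuousAt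

lemma differentiableAt_unitNormal (hρ : ContDiffAt ℝ 2 ρ p) (hp : gradient ρ p ≠ 0) :
    DifferentiableAt ℝ (unitNormal ρ) p :=
  (contDiffAt_unitNormal (k := 1) (by rwa [one_add_one_eq_two]) hp).differentiableAt one_ne_zero

lemma eventually_gradient_ne_zero (hρ : ContDiffAt ℝ 1 ρ p) (hp : gradient ρ p ≠ 0) :
    ∀ᶠ x in 𝓝 p, gradient ρ x ≠ 0 :=
  (contDiffAt_gradient (k := 0) (by rwa [zero_add])).continuousAt.eventually_ne hp

lemma norm_unitNormal (hp : gradient ρ p ≠ 0) : ‖unitNormal ρ p‖ = 1 :=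
  norm_normalize_eq_one_iff.2 hp

lemma fderiv_eq_norm_gradient_mul_inner (ρ : E → ℝ) (x v : E) :
    fderiv ℝ ρ x v = ‖gradient ρ x‖ * ⟪unitNormal ρ x, v⟫ := by
  rw [← real_inner_smul_left, unitNormal, norm_smul_normalize, inner_gradient_left]

lemma fderiv_apply_unitNormal (hp : gradient ρ p ≠ 0) :
    fderiv ℝ ρ p (unitNormal ρ p) = ‖gradient ρ p‖ := by
  rw [fderiv_eq_norm_gradient_mul_inner, real_inner_self_eq_norm_sq, norm_unitNormal hp, one_pow,
    mul_one]

lemma fderiv_apply_tangentialPart (hp : gradient ρ p ≠ 0) (ξ : E) :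
    fderiv ℝ ρ p (tangentialPart ρ p ξ) = 0 := by
  rw [tangentialPart, map_sub, map_smul, fderiv_apply_unitNormal hp,
    fderiv_eq_norm_gradient_mul_inner, smul_eq_mul, mul_comm, sub_self]

lemma inner_fderiv_unitNormal_unitNormal (hρ : ContDiffAt ℝ 2 ρ p) (hp : gradient ρ p ≠ 0)
    (v : E) : ⟪fderiv ℝ (unitNormal ρ) p v, unitNormal ρ p⟫ = 0 :=
  inner_fderiv_eq_zero_of_eventually_norm_eq_one (differentiableAt_unitNormal hρ hp)
    ((eventually_gradient_ne_zero (hρ.of_le one_le_two) hp).mono fun _ => norm_unitNormal) v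

/-- The second fundamental form of a level set: the term differentiating `‖∇ρ‖` drops out because
`w` is tangent. -/
lemma norm_gradient_mul_inner_fderiv_unitNormal (hρ : ContDiffAt ℝ 2 ρ p) (hp : gradient ρ p ≠ 0)
    {w : E} (hw : fderiv ℝ ρ p w = 0) (v : E) :
    ‖gradient ρ p‖ * ⟪fderiv ℝ (unitNormal ρ) p v, w⟫ = fderiv ℝ (fderiv ℝ ρ) p v w := by
  have hgrad : DifferentiableAt ℝ (fun x => ‖gradient ρ x‖) p :=
    ((contDiffAt_gradient (k := 1) (by rwa [one_add_one_eq_two])).differentiableAt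
      one_ne_zero).norm ℝ hp
  have hN := differentiableAt_unitNormal hρ hp
  have hNw : ⟪unitNormal ρ p, w⟫ = 0 := by
    rw [fderiv_eq_norm_gradient_mul_inner] at hw
    exact (mul_eq_zero.1 hw).resolve_left (norm_ne_zero_iff.2 hp)
  have hD : DifferentiableAt ℝ (fderiv ℝ ρ) p :=
    (hρ.fderiv_right (m := 1) one_add_one_eq_two.le).differentiableAt one_ne_zero
  have hleft : fderiv ℝ (fun x => fderiv ℝ ρ x w) p v = fderiv ℝ (fderiv ℝ ρ) p v w := by
    rw [fderiv_clm_apply hD (differentiableAt_const w)]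
    simp
  have hright : fderiv ℝ (fun x => ‖gradient ρ x‖ * ⟪unitNormal ρ x, w⟫) p v =
      ‖gradient ρ p‖ * ⟪fderiv ℝ (unitNormal ρ) p v, w⟫ := by
    rw [fderiv_fun_mul hgrad (hN.inner ℝ (differentiableAt_const w))]
    simp [hNw, fderiv_inner_apply ℝ hN (differentiableAt_const w)]
  rw [← hleft, ← hright]
  simp only [fderiv_eq_norm_gradient_mul_inner]

lemma exists_sub_eq_smul_unitNormal {x z : E} (hρ : ContDiffAt ℝ 1 ρ z) (hz : gradient ρ z ≠ 0)
    (hmin : ∀ᶠ y in 𝓝 z, ρ y = ρ z → dist x z ≤ dist x y) :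
    ∃ t : ℝ, x - z = t • unitNormal ρ z := by
  have hdist : HasStrictFDerivAt (fun y => ‖y - x‖ ^ 2)
      ((2 • innerSL ℝ (z - x)) ∘L ContinuousLinearMap.id ℝ E) z :=
    (hasStrictFDerivAt_norm_sq (z - x)).comp z ((hasStrictFDerivAt_id z).sub_const x)
  have hextr : IsLocalExtrOn (fun y => ‖y - x‖ ^ 2) {y | ρ y = ρ z} z := by
    refine .inl (eventually_nhdsWithin_iff.2 (hmin.mono fun y hy hρy => ?_))
    have hxy := hy hρy
    rw [dist_eq_norm', dist_eq_norm'] at hxy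
    exact pow_le_pow_left₀ (norm_nonneg _) hxy 2
  obtain ⟨a, b, hab, hmul⟩ := hextr.exists_multipliers_of_hasStrictFDerivAt_1d
    (hρ.hasStrictFDerivAt one_ne_zero) hdist
  have hvec : a • gradient ρ z + (2 * b) • (z - x) = 0 := by
    refine ext_inner_right ℝ fun v => ?_
    have hv := DFunLike.congr_fun hmul v
    simp only [add_apply, smul_apply, ContinuousLinearMap.comp_id, innerSL_apply_apply,
      smul_eq_mul, nsmul_eq_mul, Nat.cast_ofNat, zero_apply] at hv
    rw [inner_add_left, real_inner_smul_left, real_inner_smul_left, inner_zero_left,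
      inner_gradient_left]
    linarith
  have hb : 2 * b ≠ 0 := by
    intro hb
    have hb0 : b = 0 := by linarith
    simp_all
  refine ⟨(2 * b)⁻¹ * a * ‖gradient ρ z‖, ?_⟩
  rw [mul_smul, unitNormal, norm_smul_normalize, mul_smul, eq_inv_smul_iff₀ hb, ← neg_sub z x,
    smul_neg]
  exact (eq_neg_of_add_eq_zero_left hvec).symm

end UnitNormal

section NormalCoordinates

variable {E : Type*} [NormedAddCommGroup E]

lemma fderiv_add_smul_fderiv_eq_self [NormedSpace ℝ E] {N π : E → E} {d : E → ℝ} {x : E}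
    (hN : DifferentiableAt ℝ N (π x)) (hπ : DifferentiableAt ℝ π x) (hd : DifferentiableAt ℝ d x)
    (h : ∀ᶠ y in 𝓝 x, π y + d y • N (π y) = y) (ξ : E) :
    fderiv ℝ π x ξ + (d x • fderiv ℝ N (π x) (fderiv ℝ π x ξ) + fderiv ℝ d x ξ • N (π x)) = ξ := by
  have hsum := hπ.hasFDerivAt.add (hd.hasFDerivAt.smul (hN.hasFDerivAt.comp x hπ.hasFDerivAt))
  have hid := (hasFDerivAt_id (𝕜 := ℝ) x).congr_of_eventuallyEq h
  simpa using DFunLike.congr_fun (hsum.unique hid) ξ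

lemma exists_continuousLinearEquiv_add_smul [NormedSpace ℝ E] {φ : E →L[ℝ] ℝ} {v : E}
    (hφ : φ v ≠ 0) :
    ∃ A : (E × ℝ) ≃L[ℝ] (E × ℝ), ∀ w, A w = (w.1 + w.2 • v, φ w.1) := by
  let f : (E × ℝ) →L[ℝ] (E × ℝ) :=
    (.fst ℝ E ℝ + (ContinuousLinearMap.snd ℝ E ℝ).smulRight v).prod (φ ∘L .fst ℝ E ℝ)
  let τ : (E × ℝ) →L[ℝ] ℝ := (φ v)⁻¹ • (φ ∘L .fst ℝ E ℝ - .snd ℝ E ℝ)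
  let g : (E × ℝ) →L[ℝ] (E × ℝ) := (.fst ℝ E ℝ - τ.smulRight v).prod τ
  refine ⟨.equivOfInverse f g (fun w => ?_) (fun w => ?_), fun w => rfl⟩
  · have hcancel (s : ℝ) : (φ v)⁻¹ * (s * φ v) = s := by field_simp
    ext <;> simp [f, g, τ, hcancel]
  · have hcancel (s : ℝ) : (φ v)⁻¹ * s * φ v = s := by field_simp
    ext <;> simp [f, g, τ, hcancel]

variable [InnerProductSpace ℝ E] [CompleteSpace E] {ρ d : E → ℝ} {π : E → E} {p : E}
  {k : WithTop ℕ∞}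

/-- Moves `z` by `t` along the unit normal, and records the level `ρ z` so as to be a map between
spaces of the same dimension. Thus `normalMap ρ (z, t) = (x, 0)` says that `(z, t)` are the normal
coordinates of `x` relative to the hypersurface `{ρ = 0}`: foot point and signed distance. -/
noncomputable def normalMap (ρ : E → ℝ) (w : E × ℝ) : E × ℝ :=
  (w.1 + w.2 • unitNormal ρ w.1, ρ w.1)

lemma normalMap_eq_iff {x z : E} {t : ℝ} :
    normalMap ρ (z, t) = (x, 0) ↔ z + t • unitNormal ρ z = x ∧ ρ z = 0 :=
  Prod.mk_inj

lemma eq_self_of_normalMap_eq {x z : E} (h : normalMap ρ (z, 0) = (x, 0)) : z = x := by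
  simpa using (normalMap_eq_iff.1 h).1

lemma contDiffAt_normalMap {w : E × ℝ} (hρ : ContDiffAt ℝ (k + 1) ρ w.1)
    (hw : gradient ρ w.1 ≠ 0) : ContDiffAt ℝ k (normalMap ρ) w :=
  (contDiffAt_fst.add (contDiffAt_snd.smul ((contDiffAt_unitNormal hρ hw).comp w
    contDiffAt_fst))).prodMk ((hρ.of_le le_self_add).comp w contDiffAt_fst)

lemma exists_equiv_hasFDerivAt_normalMap (hρ : ContDiffAt ℝ 2 ρ p) (hp : gradient ρ p ≠ 0) :
    ∃ A : (E × ℝ) ≃L[ℝ] (E × ℝ), HasFDerivAt (normalMap ρ) (A : (E × ℝ) →L[ℝ] (E × ℝ)) (p, 0) := by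
  obtain ⟨A, hA⟩ := exists_continuousLinearEquiv_add_smul (φ := fderiv ℝ ρ p)
    (v := unitNormal ρ p) (by rwa [fderiv_apply_unitNormal hp, norm_ne_zero_iff])
  have hN : HasFDerivAt (unitNormal ρ) (fderiv ℝ (unitNormal ρ) p) (p, (0 : ℝ)).1 :=
    (differentiableAt_unitNormal hρ hp).hasFDerivAt
  have hρ' : HasFDerivAt ρ (fderiv ℝ ρ p) (p, (0 : ℝ)).1 :=
    (hρ.differentiableAt two_ne_zero).hasFDerivAt
  have hmap := (hasFDerivAt_fst.add (hasFDerivAt_snd.smul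
    (hN.comp (p, (0 : ℝ)) hasFDerivAt_fst))).prodMk (hρ'.comp (p, (0 : ℝ)) hasFDerivAt_fst)
  refine ⟨A, hmap.congr_fderiv (ContinuousLinearMap.ext fun w => ?_)⟩
  simp [hA]

lemma exists_localInverse_normalMap (hk : 1 ≤ k) (hρ : ∀ᶠ x in 𝓝 p, ContDiffAt ℝ (k + 1) ρ x)
    (hp : gradient ρ p ≠ 0) :
    ∃ g : E × ℝ → E × ℝ, (∀ᶠ w in 𝓝 (p, (0 : ℝ)), g (normalMap ρ w) = w) ∧
      ∀ᶠ y in 𝓝 (p, ρ p), ContDiffAt ℝ k g y := by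
  have hρ2 : ContDiffAt ℝ 2 ρ p :=
    hρ.self_of_nhds.of_le (one_add_one_eq_two.symm.le.trans (by gcongr))
  obtain ⟨A, hA⟩ := exists_equiv_hasFDerivAt_normalMap hρ2 hp
  have hsmooth : ∀ᶠ w in 𝓝 (p, (0 : ℝ)), ContDiffAt ℝ k (normalMap ρ) w := by
    have hfst : Tendsto Prod.fst (𝓝 (p, (0 : ℝ))) (𝓝 p) := continuous_fst.tendsto _
    filter_upwards [hfst.eventually hρ,
      hfst.eventually (eventually_gradient_ne_zero (hρ2.of_le one_le_two) hp)] with w hw hw'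
    exact contDiffAt_normalMap hw hw'
  simpa [normalMap] using exists_localInverse_eventually_contDiffAt hk hsmooth hA

/-- Pair the derivative of `x = π x + d x • N (π x)` with `N (π x)`: the foot point moves
tangentially, and so does the unit normal. -/
lemma hasGradientAt_of_normalMap_eq {x : E} (hρ : ContDiffAt ℝ 2 ρ (π x))
    (h0 : gradient ρ (π x) ≠ 0) (hπ : DifferentiableAt ℝ π x) (hd : DifferentiableAt ℝ d x)
    (h : ∀ᶠ y in 𝓝 x, normalMap ρ (π y, d y) = (y, 0)) :
    HasGradientAt d (unitNormal ρ (π x)) x := by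
  simp only [normalMap_eq_iff] at h
  have htangent (ξ : E) : ⟪fderiv ℝ π x ξ, unitNormal ρ (π x)⟫ = 0 := by
    have hconst : ρ ∘ π =ᶠ[𝓝 x] fun _ => 0 := h.mono fun _ hy => hy.2
    have hzero := DFunLike.congr_fun (fderiv_comp x (hρ.differentiableAt two_ne_zero) hπ) ξ
    rw [hconst.fderiv_eq, fderiv_const_apply, ContinuousLinearMap.comp_apply,
      fderiv_eq_norm_gradient_mul_inner, real_inner_comm] at hzero
    exact (mul_eq_zero.1 hzero.symm).resolve_left (norm_ne_zero_iff.2 h0)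
  rw [hasGradientAt_iff_hasFDerivAt]
  refine hd.hasFDerivAt.congr_fderiv (ContinuousLinearMap.ext fun ξ => ?_)
  have hsplit := fderiv_add_smul_fderiv_eq_self (differentiableAt_unitNormal hρ h0) hπ hd
    (h.mono fun _ hy => hy.1) ξ
  have hinner := congrArg (⟪·, unitNormal ρ (π x)⟫) hsplit
  simp only [inner_add_left, real_inner_smul_left, htangent,
    inner_fderiv_unitNormal_unitNormal hρ h0, real_inner_self_eq_norm_sq, norm_unitNormal h0]
    at hinner
  rw [InnerProductSpace.toDual_apply_apply, real_inner_comm]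
  linarith

lemma eventually_hasGradientAt_of_normalMap_eq (hρ : ContDiffAt ℝ 2 ρ p) (hp : gradient ρ p ≠ 0)
    (hdp : d p = 0) (hπ : ∀ᶠ x in 𝓝 p, DifferentiableAt ℝ π x)
    (hd : ∀ᶠ x in 𝓝 p, DifferentiableAt ℝ d x)
    (h : ∀ᶠ x in 𝓝 p, normalMap ρ (π x, d x) = (x, 0)) :
    ∀ᶠ x in 𝓝 p, HasGradientAt d (unitNormal ρ (π x)) x := by
  have hπp : π p = p := eq_self_of_normalMap_eq (hdp ▸ h.self_of_nhds)
  have hπt : Tendsto π (𝓝 p) (𝓝 p) := by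
    simpa only [ContinuousAt, hπp] using hπ.self_of_nhds.continuousAt
  filter_upwards [hπ, hd, h.eventually_nhds, hπt.eventually (hρ.eventually (by simp)),
    hπt.eventually (eventually_gradient_ne_zero (hρ.of_le one_le_two) hp)]
    with x hπx hdx hx hρx hx0
  exact hasGradientAt_of_normalMap_eq hρx hx0 hπx hdx hx

lemma fderiv_foot_eq_tangentialPart (hρ : ContDiffAt ℝ 2 ρ p) (hp : gradient ρ p ≠ 0)
    (hdp : d p = 0) (hπ : DifferentiableAt ℝ π p) (hd : DifferentiableAt ℝ d p)
    (h : ∀ᶠ x in 𝓝 p, normalMap ρ (π x, d x) = (x, 0)) (ξ : E) :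
    fderiv ℝ π p ξ = tangentialPart ρ p ξ := by
  have hπp : π p = p := eq_self_of_normalMap_eq (hdp ▸ h.self_of_nhds)
  have hgrad : HasGradientAt d (unitNormal ρ p) p := by
    simpa only [hπp] using
      hasGradientAt_of_normalMap_eq (hπp.symm ▸ hρ) (hπp.symm ▸ hp) hπ hd h
  have hsplit := fderiv_add_smul_fderiv_eq_self
    (hπp.symm ▸ differentiableAt_unitNormal hρ hp) hπ hd
    (h.mono fun _ hy => (normalMap_eq_iff.1 hy).1) ξ
  rw [hdp, zero_smul, zero_add, hπp, hgrad.fderiv_apply] at hsplit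
  exact eq_sub_of_add_eq hsplit

lemma norm_gradient_mul_fderiv_fderiv_of_normalMap_eq (hρ : ContDiffAt ℝ 2 ρ p)
    (hp : gradient ρ p ≠ 0) (hdp : d p = 0) (hπ : ∀ᶠ x in 𝓝 p, DifferentiableAt ℝ π x)
    (hd : ∀ᶠ x in 𝓝 p, DifferentiableAt ℝ d x)
    (h : ∀ᶠ x in 𝓝 p, normalMap ρ (π x, d x) = (x, 0)) (ξ ζ : E) :
    ‖gradient ρ p‖ * fderiv ℝ (fderiv ℝ d) p ξ ζ =
      fderiv ℝ (fderiv ℝ ρ) p (tangentialPart ρ p ξ) (tangentialPart ρ p ζ) := by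
  have hπp : π p = p := eq_self_of_normalMap_eq (hdp ▸ h.self_of_nhds)
  have hgrad : fderiv ℝ d =ᶠ[𝓝 p] fun x => InnerProductSpace.toDual ℝ E (unitNormal ρ (π x)) :=
    (eventually_hasGradientAt_of_normalMap_eq hρ hp hdp hπ hd h).mono
      fun _ hx => hx.hasFDerivAt.fderiv
  have hN : HasFDerivAt (unitNormal ρ) (fderiv ℝ (unitNormal ρ) p) (π p) :=
    hπp.symm ▸ (differentiableAt_unitNormal hρ hp).hasFDerivAt
  have hNπ := (InnerProductSpace.toDual ℝ E).toContinuousLinearEquiv.hasFDerivAt.comp p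
    (hN.comp p hπ.self_of_nhds.hasFDerivAt)
  have hd2 : fderiv ℝ (fderiv ℝ d) p ξ ζ =
      ⟪fderiv ℝ (unitNormal ρ) p (tangentialPart ρ p ξ), ζ⟫ := by
    rw [hgrad.fderiv_eq,
      ← fderiv_foot_eq_tangentialPart hρ hp hdp hπ.self_of_nhds hd.self_of_nhds h]
    exact DFunLike.congr_fun (DFunLike.congr_fun hNπ.fderiv ξ) ζ
  have htangent (v : E) :
      ⟪fderiv ℝ (unitNormal ρ) p v, ζ⟫ =
        ⟪fderiv ℝ (unitNormal ρ) p v, tangentialPart ρ p ζ⟫ := by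
    rw [tangentialPart, inner_sub_right, real_inner_smul_right,
      inner_fderiv_unitNormal_unitNormal hρ hp, mul_zero, sub_zero]
  rw [hd2, htangent,
    norm_gradient_mul_inner_fderiv_unitNormal hρ hp (fderiv_apply_tangentialPart hp ζ)]

end NormalCoordinates

section DefiningFunction

variable {E : Type*} [NormedAddCommGroup E] [InnerProductSpace ℝ E] [CompleteSpace E]
  {Ω : Set E} {ρ : E → ℝ} {p : E}

/-- `ρ` is a nondegenerate defining function for `Ω` near its zero `p`. Smoothness of `ρ` is kept
separate: the degree of it that is needed varies. -/
structure IsDefiningFunctionAt (Ω : Set E) (ρ : E → ℝ) (p : E) : Prop where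
  apply_eq_zero : ρ p = 0
  gradient_ne_zero : gradient ρ p ≠ 0
  mem_iff : ∀ᶠ x in 𝓝 p, x ∈ Ω ↔ ρ x < 0

namespace IsDefiningFunctionAt

lemma mem_frontier (h : IsDefiningFunctionAt Ω ρ p) : p ∈ frontier Ω := by
  have hnotMin : ¬ IsLocalMin ρ p := fun hmin =>
    h.gradient_ne_zero (by rw [gradient, hmin.fderiv_eq_zero, map_zero])
  have hfreq : ∃ᶠ x in 𝓝 p, ρ x < 0 := by
    simpa only [IsLocalMin, IsMinFilter, h.apply_eq_zero, not_eventually, not_le] using hnotMin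
  refine ⟨mem_closure_iff_frequently.2 ((hfreq.and_eventually h.mem_iff).mono fun x hx =>
    hx.2.2 hx.1), fun hint => ?_⟩
  exact (h.mem_iff.self_of_nhds.1 (interior_subset hint)).ne h.apply_eq_zero

lemma eventually (h : IsDefiningFunctionAt Ω ρ p) (hρ : ContDiffAt ℝ 1 ρ p) :
    ∀ᶠ x in 𝓝 p, ρ x = 0 → IsDefiningFunctionAt Ω ρ x := by
  filter_upwards [eventually_gradient_ne_zero hρ h.gradient_ne_zero, h.mem_iff.eventually_nhds]
    with x hgrad hmem h0 using ⟨h0, hgrad, hmem⟩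

lemma eventually_mem_frontier_iff (h : IsDefiningFunctionAt Ω ρ p) (hρ : ContDiffAt ℝ 1 ρ p) :
    ∀ᶠ x in 𝓝 p, x ∈ frontier Ω ↔ ρ x = 0 := by
  filter_upwards [h.eventually hρ, hρ.eventually (by simp), h.mem_iff.eventually_nhds]
    with x hx hρx hmem
  exact ⟨eq_zero_of_mem_frontier_of_mem_iff_neg hρx.continuousAt hmem,
    fun h0 => (hx h0).mem_frontier⟩

end IsDefiningFunctionAt

lemma eventually_apply_add_smul_unitNormal_neg_iff (hρ : ContDiffAt ℝ 1 ρ p)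
    (hp : gradient ρ p ≠ 0) :
    ∀ᶠ w in 𝓝 (p, (0 : ℝ)),
      ρ w.1 = 0 → (ρ (w.1 + w.2 • unitNormal ρ w.1) < 0 ↔ w.2 < 0) := by
  set c := ‖gradient ρ p‖ / 2
  have hcpos : 0 < c := half_pos (norm_pos_iff.2 hp)
  have hN : ContinuousAt (fun w : E × ℝ => unitNormal ρ w.1) (p, 0) :=
    ContinuousAt.comp' (f := Prod.fst) (x := (p, (0 : ℝ))) (continuousAt_unitNormal hρ hp)
      continuousAt_fst
  have hpair : Tendsto (fun w : E × ℝ => (w.1 + w.2 • unitNormal ρ w.1, w.1)) (𝓝 (p, 0))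
      (𝓝 (p, p)) := by
    have hcont := (continuousAt_fst.add (continuousAt_snd.smul hN)).prodMk continuousAt_fst
    simpa [ContinuousAt] using hcont
  have hslope : ∀ᶠ w in 𝓝 (p, (0 : ℝ)), c < fderiv ℝ ρ p (unitNormal ρ w.1) := by
    have hcont := (fderiv ℝ ρ p).continuous.continuousAt.comp hN
    refine hcont.eventually_const_lt ?_
    simpa only [Function.comp_apply, fderiv_apply_unitNormal hp] using
      half_lt_self (norm_pos_iff.2 hp)
  have happrox := hpair.eventually ((hρ.hasStrictFDerivAt one_ne_zero).isLittleO.def hcpos)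
  filter_upwards [happrox, hslope,
    continuousAt_fst.eventually (eventually_gradient_ne_zero hρ hp)] with w hw hcw hw0 hρw
  rw [hρw, sub_zero, add_sub_cancel_left, map_smul, norm_smul, norm_unitNormal hw0, mul_one,
    smul_eq_mul, Real.norm_eq_abs, Real.norm_eq_abs, abs_le] at hw
  constructor
  · intro hneg
    by_contra! ht
    rw [abs_of_nonneg ht] at hw
    nlinarith [hw.1]
  · intro ht
    rw [abs_of_neg ht] at hw
    nlinarith [hw.2]

end DefiningFunction

section SignedDistance

variable {n : ℕ} {Ω : Set (Eucl n)} {ρ : Eucl n → ℝ} {p : Eucl n} {k : WithTop ℕ∞}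

lemma signedBoundaryDist_eq_of_abs_eq {x : Eucl n} {t : ℝ}
    (habs : |t| = Metric.infDist x (frontier Ω)) (hsign : x ∈ Ω ↔ t < 0) :
    signedBoundaryDist Ω x = t := by
  unfold signedBoundaryDist
  split_ifs with hx
  · rw [← habs, abs_of_neg (hsign.1 hx), neg_neg]
  · rw [← habs, abs_of_nonneg (not_lt.1 (mt hsign.2 hx))]

lemma signedBoundaryDist_of_mem_frontier (hp : p ∈ frontier Ω) : signedBoundaryDist Ω p = 0 := by
  simp [signedBoundaryDist, Metric.infDist_zero_of_mem hp]

namespace IsDefiningFunctionAt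

lemma eventually_exists_normalMap_eq (h : IsDefiningFunctionAt Ω ρ p) (hρ : ContDiffAt ℝ 1 ρ p)
    {P : Eucl n × ℝ → Prop} (hP : ∀ᶠ w in 𝓝 (p, 0), P w) :
    ∀ᶠ x in 𝓝 p, ∃ z, P (z, signedBoundaryDist Ω x) ∧
      normalMap ρ (z, signedBoundaryDist Ω x) = (x, 0) := by
  have hne : (frontier Ω).Nonempty := ⟨p, h.mem_frontier⟩
  choose z hzΩ hz using isClosed_frontier.exists_infDist_eq_dist hne
  have hzp : Tendsto z (𝓝 p) (𝓝 p) := tendsto_of_infDist_eq_dist h.mem_frontier hz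
  let t (x : Eucl n) : ℝ := ⟪unitNormal ρ (z x), x - z x⟫
  have hzt : Tendsto (fun x => (z x, t x)) (𝓝 p) (𝓝 (p, 0)) := by
    have hN := (continuousAt_unitNormal hρ h.gradient_ne_zero).tendsto.comp hzp
    have ht : Tendsto t (𝓝 p) (𝓝 ⟪unitNormal ρ p, p - p⟫) := hN.inner (tendsto_id.sub hzp)
    rw [sub_self, inner_zero_right] at ht
    exact hzp.prodMk_nhds ht
  filter_upwards [h.mem_iff, hzp.eventually (h.eventually hρ),
    hzp.eventually (h.eventually_mem_frontier_iff hρ).eventually_nhds,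
    hzp.eventually (hρ.eventually (by simp)), hzt.eventually hP,
    hzt.eventually (eventually_apply_add_smul_unitNormal_neg_iff hρ h.gradient_ne_zero)]
    with x hxΩ hdef hfr hρz hPx hsign
  have hρz0 : ρ (z x) = 0 := hfr.self_of_nhds.1 (hzΩ x)
  have hz0 := (hdef hρz0).gradient_ne_zero
  have hnormal : x - z x = t x • unitNormal ρ (z x) := by
    obtain ⟨s, hs⟩ := exists_sub_eq_smul_unitNormal (x := x) hρz hz0 <|
      hfr.mono fun y hy hρy => hz x ▸ Metric.infDist_le_dist_of_mem (hy.2 (hρy.trans hρz0))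
    simp only [t, hs, real_inner_smul_right, real_inner_self_eq_norm_sq, norm_unitNormal hz0,
      one_pow, mul_one]
  have hx : z x + t x • unitNormal ρ (z x) = x := by rw [← hnormal, add_sub_cancel]
  have hδ : signedBoundaryDist Ω x = t x := by
    refine signedBoundaryDist_eq_of_abs_eq ?_ ?_
    · rw [hz, dist_eq_norm, hnormal, norm_smul, norm_unitNormal hz0, mul_one, Real.norm_eq_abs]
    · rw [hxΩ, ← hsign hρz0, hx]
  exact ⟨z x, hδ ▸ hPx, normalMap_eq_iff.2 ⟨hδ ▸ hx, hρz0⟩⟩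

lemma exists_foot (h : IsDefiningFunctionAt Ω ρ p) (hk : 1 ≤ k)
    (hρ : ∀ᶠ x in 𝓝 p, ContDiffAt ℝ (k + 1) ρ x) :
    ∃ π : Eucl n → Eucl n, (∀ᶠ x in 𝓝 p, ContDiffAt ℝ k π x) ∧
      (∀ᶠ x in 𝓝 p, ContDiffAt ℝ k (signedBoundaryDist Ω) x) ∧
      ∀ᶠ x in 𝓝 p, normalMap ρ (π x, signedBoundaryDist Ω x) = (x, 0) := by
  obtain ⟨g, hg, hgk⟩ := exists_localInverse_normalMap hk hρ h.gradient_ne_zero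
  rw [h.apply_eq_zero] at hgk
  have hcoord : ∀ᶠ x in 𝓝 p, (g (x, 0)).2 = signedBoundaryDist Ω x ∧
      normalMap ρ ((g (x, 0)).1, signedBoundaryDist Ω x) = (x, 0) := by
    filter_upwards [h.eventually_exists_normalMap_eq
      (hρ.self_of_nhds.of_le (hk.trans le_self_add)) hg] with x ⟨z, hgz, hzx⟩
    rw [hzx] at hgz
    simp only [hgz, hzx, and_self]
  have hslice : Tendsto (fun x : Eucl n => (x, (0 : ℝ))) (𝓝 p) (𝓝 (p, 0)) :=
    (Continuous.prodMk_left 0).tendsto p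
  have hgslice : ∀ᶠ x in 𝓝 p, ContDiffAt ℝ k (fun y => g (y, 0)) x :=
    (hslice.eventually hgk).mono fun x hx =>
      ContDiffAt.comp (g := g) x hx (contDiffAt_id.prodMk contDiffAt_const)
  refine ⟨fun x => (g (x, 0)).1, hgslice.mono fun _ => ContDiffAt.fst, ?_,
    hcoord.mono fun _ hx => hx.2⟩
  filter_upwards [hgslice, hcoord.eventually_nhds] with x hx hδ
  exact hx.snd.congr_of_eventuallyEq (hδ.mono fun _ hy => hy.1.symm)

lemma eventually_contDiffAt_signedBoundaryDist (h : IsDefiningFunctionAt Ω ρ p) (hk : 1 ≤ k)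
    (hρ : ∀ᶠ x in 𝓝 p, ContDiffAt ℝ (k + 1) ρ x) :
    ∀ᶠ x in 𝓝 p, ContDiffAt ℝ (k + 1) (signedBoundaryDist Ω) x := by
  obtain ⟨π, hπ, hδ, hnormal⟩ := h.exists_foot hk hρ
  have hk0 : k ≠ 0 := by positivity
  have hρ2 : ContDiffAt ℝ 2 ρ p :=
    hρ.self_of_nhds.of_le (one_add_one_eq_two.symm.le.trans (by gcongr))
  have hδp := signedBoundaryDist_of_mem_frontier h.mem_frontier
  have hgrad := eventually_hasGradientAt_of_normalMap_eq hρ2 h.gradient_ne_zero hδp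
    (hπ.mono fun _ hx => hx.differentiableAt hk0) (hδ.mono fun _ hx => hx.differentiableAt hk0)
    hnormal
  have hπt : Tendsto π (𝓝 p) (𝓝 p) := by
    have hπp : π p = p := eq_self_of_normalMap_eq (hδp ▸ hnormal.self_of_nhds)
    simpa only [ContinuousAt, hπp] using hπ.self_of_nhds.continuousAt
  refine eventually_contDiffAt_succ hk hδ ?_
  filter_upwards [hπ, hgrad.eventually_nhds, hπt.eventually hρ, hπt.eventually
    (eventually_gradient_ne_zero (hρ2.of_le one_le_two) h.gradient_ne_zero)]
    with x hπx hx hρx hx0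
  have hNπ : ContDiffAt ℝ k (fun y => unitNormal ρ (π y)) x :=
    (contDiffAt_unitNormal hρx hx0).comp x hπx
  have hdual := (InnerProductSpace.toDual ℝ (Eucl n)).contDiff.contDiffAt.comp x hNπ
  exact hdual.congr_of_eventuallyEq (hx.mono fun _ hy => hy.hasFDerivAt.fderiv)

lemma norm_gradient_mul_fderiv_fderiv_signedBoundaryDist (h : IsDefiningFunctionAt Ω ρ p)
    (hρ : ContDiffAt ℝ 2 ρ p) (ξ ζ : Eucl n) :
    ‖gradient ρ p‖ * fderiv ℝ (fderiv ℝ (signedBoundaryDist Ω)) p ξ ζ =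
      fderiv ℝ (fderiv ℝ ρ) p (tangentialPart ρ p ξ) (tangentialPart ρ p ζ) := by
  obtain ⟨π, hπ, hδ, hnormal⟩ := h.exists_foot (k := 1) le_rfl
    (by simpa only [one_add_one_eq_two] using hρ.eventually (by simp))
  exact norm_gradient_mul_fderiv_fderiv_of_normalMap_eq hρ h.gradient_ne_zero
    (signedBoundaryDist_of_mem_frontier h.mem_frontier)
    (hπ.mono fun _ hx => hx.differentiableAt one_ne_zero)
    (hδ.mono fun _ hx => hx.differentiableAt one_ne_zero) hnormal ξ ζ

end IsDefiningFunctionAt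

lemma isDefiningFunctionAt_of_mem_frontier {U : Set (Eucl n)} (hU : IsOpen U)
    (hρ : ContinuousOn ρ U) (hΩ : Ω ∩ U = {x | x ∈ U ∧ ρ x < 0}) (hp : p ∈ frontier Ω ∩ U)
    (hp0 : gradient ρ p ≠ 0) : IsDefiningFunctionAt Ω ρ p := by
  have hpU := hU.mem_nhds hp.2
  have hmem : ∀ᶠ x in 𝓝 p, x ∈ Ω ↔ ρ x < 0 := by
    filter_upwards [hpU] with x hx
    simpa [hx] using Set.ext_iff.1 hΩ x
  exact ⟨eq_zero_of_mem_frontier_of_mem_iff_neg (hρ.continuousAt hpU) hmem hp.1, hp0, hmem⟩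

end SignedDistance

section Hessian

variable {n : ℕ}

lemma partialDeriv_partialDeriv {f : Eucl n → ℝ} {x : Eucl n} (hf : ContDiffAt ℝ 2 f x)
    (j k : Fin n) :
    partialDeriv j (partialDeriv k f) x =
      fderiv ℝ (fderiv ℝ f) x (EuclideanSpace.single j 1) (EuclideanSpace.single k 1) := by
  have hD : DifferentiableAt ℝ (fderiv ℝ f) x :=
    (hf.fderiv_right (m := 1) one_add_one_eq_two.le).differentiableAt one_ne_zero
  unfold partialDeriv
  rw [fderiv_clm_apply hD (differentiableAt_const _)]
  simp

lemma realHessian_eq_fderiv_fderiv {f : Eucl n → ℝ} {x : Eucl n} (hf : ContDiffAt ℝ 2 f x)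
    (ξ ζ : Eucl n) : realHessian f ξ ζ x = fderiv ℝ (fderiv ℝ f) x ξ ζ := by
  have hsum (v : Eucl n) : ∑ j, v j • EuclideanSpace.single j (1 : ℝ) = v := by
    simpa using (EuclideanSpace.basisFun (Fin n) ℝ).sum_repr v
  calc realHessian f ξ ζ x
      = fderiv ℝ (fderiv ℝ f) x (∑ j, ξ j • EuclideanSpace.single j (1 : ℝ))
          (∑ k, ζ k • EuclideanSpace.single k (1 : ℝ)) := by
        simp only [realHessian, partialDeriv_partialDeriv hf, map_sum, map_smul, sum_apply,
          smul_apply, smul_eq_mul, Finset.mul_sum]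
        rw [Finset.sum_comm]
        exact Finset.sum_congr rfl fun _ _ => Finset.sum_congr rfl fun _ _ => by ring
    _ = fderiv ℝ (fderiv ℝ f) x ξ ζ := by rw [hsum, hsum]

end Hessian

theorem corollaryC_general {n : ℕ} {Ω U : Set (Eucl n)} {ρ : Eucl n → ℝ} {k : WithTop ℕ∞}
    (hk : 1 ≤ k) (hU : IsOpen U) (hρ : ContDiffOn ℝ (k + 1) ρ U)
    (hΩ : Ω ∩ U = {x | x ∈ U ∧ ρ x < 0}) (hgrad : ∀ x ∈ frontier Ω ∩ U, gradient ρ x ≠ 0)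
    (hconv : ∀ q ∈ U ∩ frontier Ω, ∀ ξ ∈ boundaryTangentSpace ρ q, 0 ≤ realHessian ρ ξ ξ q) :
    (∃ V : Set (Eucl n), IsOpen V ∧ frontier Ω ∩ U ⊆ V ∧
        ContDiffOn ℝ (k + 1) (signedBoundaryDist Ω) V) ∧
      ∀ x ∈ frontier Ω ∩ U, ∀ ξ : Eucl n, 0 ≤ realHessian (signedBoundaryDist Ω) ξ ξ x := by
  have h2k : 2 ≤ k + 1 := one_add_one_eq_two.symm.le.trans (by gcongr)
  have hρat {x : Eucl n} (hx : x ∈ U) : ContDiffAt ℝ (k + 1) ρ x := hρ.contDiffAt (hU.mem_nhds hx)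
  have hdef {x : Eucl n} (hx : x ∈ frontier Ω ∩ U) : IsDefiningFunctionAt Ω ρ x :=
    isDefiningFunctionAt_of_mem_frontier hU hρ.continuousOn hΩ hx (hgrad x hx)
  have hδ {x : Eucl n} (hx : x ∈ frontier Ω ∩ U) :
      ∀ᶠ y in 𝓝 x, ContDiffAt ℝ (k + 1) (signedBoundaryDist Ω) y :=
    (hdef hx).eventually_contDiffAt_signedBoundaryDist hk
      (eventually_of_mem (hU.mem_nhds hx.2) fun _ => hρat)
  refine ⟨⟨interior {x | ContDiffAt ℝ (k + 1) (signedBoundaryDist Ω) x}, isOpen_interior,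
    fun x hx => mem_interior_iff_mem_nhds.2 (hδ hx),
    fun x hx => (Set.mem_ofPred.1 (interior_subset hx)).contDiffWithinAt⟩, fun x hx ξ => ?_⟩
  have hρ2 : ContDiffAt ℝ 2 ρ x := (hρat hx.2).of_le h2k
  have htangent : tangentialPart ρ x ξ ∈ boundaryTangentSpace ρ x := by
    rw [boundaryTangentSpace, Set.mem_ofPred_eq, inner_gradient_left]
    exact fderiv_apply_tangentialPart (hgrad x hx) ξ
  have hHess := hconv x hx.symm _ htangent
  rw [realHessian_eq_fderiv_fderiv hρ2,
    ← (hdef hx).norm_gradient_mul_fderiv_fderiv_signedBoundaryDist hρ2] at hHess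
  rw [realHessian_eq_fderiv_fderiv ((hδ hx).self_of_nhds.of_le h2k)]
  exact nonneg_of_mul_nonneg_right hHess (norm_pos_iff.2 (hgrad x hx))

/-- If the smoothly bounded open set `Ω` is convex in a neighborhood `U` of `p ∈ bΩ`, then its signed
distance function is smooth near `bΩ ∩ U` and its Hessian is nonnegative in all directions
at all points of `bΩ ∩ U`. -/
theorem corollaryC (n : ℕ) (Ω U : Set (Eucl n)) (p : Eucl n)
    (hΩ : IsSmoothlyBounded Ω) (hp : p ∈ frontier Ω)
    (hU : IsOpen U) (hpU : p ∈ U) (hconv : IsConvexDomainIn Ω U) :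
    (∃ V : Set (Eucl n), IsOpen V ∧ frontier Ω ∩ U ⊆ V ∧ ContDiffOn ℝ ∞ (signedBoundaryDist Ω) V) ∧
      ∀ x ∈ frontier Ω ∩ U, ∀ ξ : Eucl n, 0 ≤ realHessian (signedBoundaryDist Ω) ξ ξ x := by
  obtain ⟨ρ, ⟨hρ, hρΩ, hgrad⟩, hHess⟩ := hconv
  exact corollaryC_general (k := ∞) (by simp) hU hρ hρΩ hgrad hHess
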